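/- Let $K$ be an arbitrary field, $R=K[x_1,\dots,x_5]$ with its standard grading, and let $f_1,\dots,f_5,g_1,g_2,g_3\in R$ be $K$-linearly independent quadratic forms such that $f_1,\dots,f_5$ is a regular sequence in $R$. Put $\mathfrak f=(f_1,\dots,f_5)$, $A=R/\mathfrak f$ (a graded $K$-algebra with degree-one component $A_1$) and $I=\mathfrak f+(g_1,g_2,g_3)$; such an $I$ is called a defect three quadratic ideal. If $$\dim_K\{\ell\in A_1 : \ell g_1=\ell g_2=\ell g_3=0 \text{ in } A\}=0,$$ then $\mathrm{HF}_{R/I}(3):=\dim_K (R/I)_3\le 4$. -/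

import Mathlib

namespace QuadricEGH

variable {K : Type*} [Field K] {n : ℕ}

/-- The degree `d` component `[R/I]_d` of `R/I`, where `R = K[x_1, …, x_n]`: the image of the space
`R_d` of forms of degree `d`. It is used for homogeneous ideals `I`. -/
noncomputable def gradedPiece (I : Ideal (MvPolynomial (Fin n) K)) (d : ℕ) :
    Submodule K (MvPolynomial (Fin n) K ⧸ I) :=
  (MvPolynomial.homogeneousSubmodule (Fin n) K d).map (Ideal.Quotient.mkₐ K I).toLinearMap

/-- The Hilbert function `HF_{R/I}(d) = dim_K [R/I]_d`. -/
noncomputable def hilbertFunction (I : Ideal (MvPolynomial (Fin n) K)) (d : ℕ) : ℕ :=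
  Module.finrank K (gradedPiece I d)

/-- The space `Ann_{A_d}(g_1, …, g_δ)` of elements of degree `d` of `A = R/𝔣` that annihilate the
images in `A` of all the `g_j`. -/
noncomputable def annPiece (𝔣 : Ideal (MvPolynomial (Fin n) K)) {δ : ℕ}
    (g : Fin δ → MvPolynomial (Fin n) K) (d : ℕ) :
    Submodule K (MvPolynomial (Fin n) K ⧸ 𝔣) where
  carrier := {a | a ∈ gradedPiece 𝔣 d ∧ ∀ j, a * Ideal.Quotient.mk 𝔣 (g j) = 0}
  add_mem' := fun ha hb =>
    ⟨add_mem ha.1 hb.1, fun j => by rw [add_mul, ha.2 j, hb.2 j, add_zero]⟩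
  zero_mem' := ⟨zero_mem _, fun j => zero_mul _⟩
  smul_mem' := fun c a ha =>
    ⟨Submodule.smul_mem _ c ha.1, fun j => by rw [smul_mul_assoc, ha.2 j, smul_zero]⟩

/-- `I = 𝔣 + (g_1, …, g_δ)`, with `𝔣 = (f_1, …, f_n)`, is a defect `δ` quadratic ideal of
`R = K[x_1, …, x_n]`: the `f_i` and `g_j` are quadratic forms generating `I`, the `f_i` form a
regular sequence, and the `n + δ` generators are linearly independent over `K` (since all of them
have the same degree, this says that they generate `I` minimally). -/
structure IsDefectQuadraticIdeal (I : Ideal (MvPolynomial (Fin n) K)) (δ : ℕ)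
    (f : Fin n → MvPolynomial (Fin n) K) (g : Fin δ → MvPolynomial (Fin n) K) : Prop where
  eq_sup : I = Ideal.span (Set.range f) ⊔ Ideal.span (Set.range g)
  quadratic_f : ∀ i, (f i).IsHomogeneous 2
  quadratic_g : ∀ j, (g j).IsHomogeneous 2
  regular : RingTheory.Sequence.IsRegular (MvPolynomial (Fin n) K) (List.ofFn f)
  linearIndependent : LinearIndependent K (Sum.elim f g)

end QuadricEGH

/-! Let `V` be the span of the `g j` in `A_2`, of dimension 3. The complete intersection `A` has
Hilbert series `(1+t)^5`, so `dim A_3 = 10`, and it suffices to show `dim A_1 V ≥ 6`.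

The main tool bounds annihilators: if `L ⊆ A_1` has dimension `k` and kills `U ⊆ A_d`, then `U = 0`
when `d < k` and `dim U ≤ 1` when `d = k`. To see this, complete a basis of `L` to coordinates `y`
and replace the `f i` by generic combinations `h j`, such that `y_0, …, y_{i-1}, h_0, …, h_{j-1}` is
a regular sequence whenever `i + j ≤ n`. Trading one `h` for one `y` embeds the annihilator of `L`
in degree `d` into one in degree `d - 1`; after `k` trades only constants can remain.

Over an algebraically closed field, if `dim A_1 V ≤ 5 = dim A_1`, an eigenvector argument gives
nonzero `l ∈ A_1`, `g ∈ V` with `l g = 0`. Split `V` into `V' = ker l ∩ V` and `W = l V`; then `dim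
A_1 V ≥ dim A_1 V' + dim A_1 W`. Both are nonzero because `V` has no common linear annihilator, and
the annihilator bound makes the sum at least 6 in either case. A general field is reduced to its
algebraic closure by applying linear functionals to coefficients. -/

namespace QuadricEGH

open MvPolynomial

/-! ### Regular elements modulo an ideal and generic regular sequences -/

section RegularModulo

variable {S : Type*} [CommRing S]

/-- Multiplication by `a` is injective on `S ⧸ J`. -/
def IsRegularMod (J : Ideal S) (a : S) : Prop := ∀ z, a * z ∈ J → z ∈ J

theorem mem_sup_span_singleton {J : Ideal S} {a z : S} :
    z ∈ J ⊔ Ideal.span {a} ↔ ∃ w, z - a * w ∈ J := by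
  constructor
  · intro h
    obtain ⟨u, hu, v, hv, rfl⟩ := Submodule.mem_sup.1 h
    obtain ⟨w, rfl⟩ := Ideal.mem_span_singleton'.1 hv
    exact ⟨w, by simpa [mul_comm] using hu⟩
  · rintro ⟨w, hw⟩
    have := Ideal.add_mem _ (Ideal.mem_sup_left (T := Ideal.span {a}) hw)
      (Ideal.mem_sup_right (S := J) (Ideal.mul_mem_right w _ (Ideal.mem_span_singleton_self a)))
    simpa using this

/-- If `a, b` is a regular sequence modulo `J`, then `a` is regular modulo `J + (b)`. -/
theorem IsRegularMod.swap {J : Ideal S} {a b : S} (ha : IsRegularMod J a)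
    (hb : IsRegularMod (J ⊔ Ideal.span {a}) b) : IsRegularMod (J ⊔ Ideal.span {b}) a := by
  intro z hz
  obtain ⟨w, hw⟩ := mem_sup_span_singleton.1 hz
  have h1 : b * w ∈ J ⊔ Ideal.span {a} :=
    mem_sup_span_singleton.2 ⟨z, by simpa using J.neg_mem hw⟩
  obtain ⟨w', hw'⟩ := mem_sup_span_singleton.1 (hb w h1)
  -- Modulo `J`, `a z = b w` and `w = a w'`, so `a` can be cancelled to give `z = b w'`.
  refine mem_sup_span_singleton.2 ⟨w', ha _ ?_⟩
  have : a * (z - b * w') = (a * z - b * w) + b * (w - a * w') := by ring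
  rw [this]
  exact J.add_mem hw (J.mul_mem_left _ hw')

theorem exists_associatedPrime_of_not_isRegularMod [IsNoetherianRing S] {J : Ideal S} {a : S}
    (h : ¬ IsRegularMod J a) : ∃ P ∈ associatedPrimes S (S ⧸ J), a ∈ P := by
  have key : a ∈ ⋃ p ∈ associatedPrimes S (S ⧸ J), (p : Set S) := by
    rw [biUnion_associatedPrimes_eq_zero_divisors]
    simp only [IsRegularMod, not_forall] at h
    obtain ⟨z, hz, hz'⟩ := h
    refine ⟨Ideal.Quotient.mk J z, fun h0 => hz' (Ideal.Quotient.eq_zero_iff_mem.1 h0), ?_⟩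
    rw [Algebra.smul_def, Ideal.Quotient.algebraMap_eq, ← map_mul]
    exact Ideal.Quotient.eq_zero_iff_mem.2 hz
  simpa using key

theorem IsRegularMod.notMem_of_associatedPrime [IsNoetherianRing S] {J : Ideal S} {a : S}
    (h : IsRegularMod J a) {P : Ideal S} (hP : P ∈ associatedPrimes S (S ⧸ J)) : a ∉ P := by
  intro haP
  have key : a ∈ ⋃ p ∈ associatedPrimes S (S ⧸ J), (p : Set S) := by
    simp only [Set.mem_iUnion]; exact ⟨P, hP, haP⟩
  rw [biUnion_associatedPrimes_eq_zero_divisors] at key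
  obtain ⟨x, hx, hx'⟩ := key
  obtain ⟨z, rfl⟩ := Ideal.Quotient.mk_surjective x
  rw [Algebra.smul_def, Ideal.Quotient.algebraMap_eq, ← map_mul] at hx'
  exact hx (Ideal.Quotient.eq_zero_iff_mem.2 (h z (Ideal.Quotient.eq_zero_iff_mem.1 hx')))

/-- Prime avoidance for a vector space `F` over an infinite field. -/
theorem exists_mem_isRegularMod {K : Type*} [Field K] [Infinite K] [Algebra K S]
    [IsNoetherianRing S] (F : Submodule K S) {ι : Type*} [Finite ι] (J : ι → Ideal S) (y : ι → S)
    (hy : ∀ i, IsRegularMod (J i) (y i))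
    (hF : ∀ P : Ideal S, P.IsPrime → (F : Set S) ⊆ P → ∀ i, y i ∈ P) :
    ∃ h ∈ F, ∀ i, IsRegularMod (J i) h := by
  by_contra! hcon
  let T : Type _ := Σ i, associatedPrimes S (S ⧸ J i)
  have : ∀ i, Finite (associatedPrimes S (S ⧸ J i)) := fun i =>
    (associatedPrimes.finite S (S ⧸ J i)).to_subtype
  have hT : Finite T := inferInstance
  let p : T → Submodule K F := fun t => (t.2.1.restrictScalars K).comap F.subtype
  have hcover : ⋃ t, (p t : Set F) = Set.univ := by
    ext x
    simp only [Set.mem_iUnion, Set.mem_univ, iff_true]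
    obtain ⟨i, hi⟩ := hcon x.1 x.2
    obtain ⟨P, hP, hxP⟩ := exists_associatedPrime_of_not_isRegularMod hi
    exact ⟨⟨i, P, hP⟩, hxP⟩
  -- A vector space over an infinite field is not a finite union of proper subspaces, so one
  -- associated prime contains all of `F`, hence also `y i`, which is regular.
  obtain ⟨⟨i, P, hP⟩, ht⟩ := Subspace.exists_eq_top_of_iUnion_eq_univ hcover
  refine (hy i).notMem_of_associatedPrime hP (hF P hP.isPrime (fun x hx => ?_) i)
  have : (⟨x, hx⟩ : F) ∈ p ⟨i, P, hP⟩ := by rw [ht]; trivial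
  exact this

/-- The ideal generated by `y 0, …, y (i - 1)` and `h 0, …, h (j - 1)`. -/
def mixedIdeal (y h : ℕ → S) (i j : ℕ) : Ideal S :=
  Ideal.span (y '' Set.Iio i ∪ h '' Set.Iio j)

theorem mixedIdeal_succ_left (y h : ℕ → S) (i j : ℕ) :
    mixedIdeal y h (i + 1) j = mixedIdeal y h i j ⊔ Ideal.span {y i} := by
  rw [mixedIdeal, mixedIdeal, ← Ideal.span_union, ← Order.succ_eq_add_one, Order.Iio_succ,
    ← Set.Iio_insert, Set.image_insert_eq]
  congr 1
  rw [Set.insert_union, Set.union_singleton]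

theorem mixedIdeal_succ_right (y h : ℕ → S) (i j : ℕ) :
    mixedIdeal y h i (j + 1) = mixedIdeal y h i j ⊔ Ideal.span {h j} := by
  rw [mixedIdeal, mixedIdeal, ← Ideal.span_union, ← Order.succ_eq_add_one, Order.Iio_succ,
    ← Set.Iio_insert, Set.image_insert_eq]
  congr 1
  rw [Set.union_insert, Set.union_singleton]

theorem mixedIdeal_congr {y h h' : ℕ → S} {i j : ℕ} (H : ∀ m < j, h m = h' m) :
    mixedIdeal y h i j = mixedIdeal y h' i j := by
  rw [mixedIdeal, mixedIdeal]
  congr 2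
  exact Set.image_congr fun m hm => H m hm

/-- Generic elements `h 0, h 1, …` of `F` form regular sequences together with the `y i`. -/
theorem exists_generic_sequence {K : Type*} [Field K] [Infinite K] [Algebra K S]
    [IsNoetherianRing S] (F : Submodule K S) (n : ℕ) (y : ℕ → S)
    (hy : ∀ i < n, IsRegularMod (mixedIdeal y 0 i 0) (y i))
    (hF : ∀ P : Ideal S, P.IsPrime → (F : Set S) ⊆ P → ∀ i, y i ∈ P) (j : ℕ) :
    ∃ h : ℕ → S, (∀ m, h m ∈ F) ∧
      (∀ i j', i + j' < n → j' ≤ j → IsRegularMod (mixedIdeal y h i j') (y i)) ∧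
      (∀ i j', i + j' < n → j' < j → IsRegularMod (mixedIdeal y h i j') (h j')) := by
  induction j with
  | zero =>
    refine ⟨0, fun m => F.zero_mem, fun i j' hi hj => ?_, fun i j' hi hj => absurd hj (by omega)⟩
    obtain rfl : j' = 0 := by omega
    exact hy i hi
  | succ j ih =>
    obtain ⟨h, hhF, h1, h2⟩ := ih
    -- The new element must be regular modulo all the ideals with `i < n - j` at once; the known
    -- regular element `y i` rules out the bad primes of each.
    obtain ⟨a, haF, ha⟩ := exists_mem_isRegularMod F
      (ι := Fin (n - j)) (fun i => mixedIdeal y h i j) (fun i => y i)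
      (fun i => h1 i j (by omega) le_rfl) (fun P hP hPF i => hF P hP hPF i)
    have hJ : ∀ i j', j' ≤ j →
        mixedIdeal y (Function.update h j a) i j' = mixedIdeal y h i j' := fun i j' hj =>
      mixedIdeal_congr fun m hm => Function.update_of_ne (by omega) _ _
    have ha' : ∀ i, i + j < n → IsRegularMod (mixedIdeal y h i j) a := fun i hi =>
      ha ⟨i, by omega⟩
    refine ⟨Function.update h j a, fun m => ?_, fun i j' hi hj => ?_, fun i j' hi hj => ?_⟩
    · rcases eq_or_ne m j with rfl | hm
      · simpa using haF
      · simpa [hm] using hhF m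
    · rcases Nat.lt_or_ge j j' with hj' | hj'
      · obtain rfl : j' = j + 1 := by omega
        rw [mixedIdeal_succ_right, hJ i j le_rfl, Function.update_self]
        refine (h1 i j (by omega) le_rfl).swap ?_
        rw [← mixedIdeal_succ_left]
        exact ha' (i + 1) (by omega)
      · rw [hJ i j' hj']
        exact h1 i j' hi hj'
    · rw [hJ i j' (by omega)]
      rcases eq_or_ne j' j with rfl | hm
      · rw [Function.update_self]
        exact ha' i hi
      · rw [Function.update_of_ne hm]
        exact h2 i j' hi (by omega)

end RegularModulo

/-! ### Linear changes of coordinates -/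

section Coordinates

variable {K : Type*} [Field K] {n : ℕ}

/-- The kernels of the iterates stabilise at some `k`; a kernel element has the form `φ^k w`, with
`w` in `ker φ^(k+1) = ker φ^k`. -/
theorem injective_of_surjective_of_isNoetherianRing {S : Type*} [CommRing S]
    [IsNoetherianRing S] (φ : S →+* S) (hφ : Function.Surjective φ) : Function.Injective φ := by
  have hmono : Monotone fun k : ℕ => RingHom.ker (φ ^ k) := by
    refine monotone_nat_of_le_succ fun k z hz => ?_
    rw [RingHom.mem_ker] at hz ⊢
    rw [pow_succ', RingHom.mul_def, RingHom.comp_apply, hz, map_zero]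
  obtain ⟨k, hk⟩ := monotone_stabilizes_iff_noetherian.2 (inferInstance : IsNoetherianRing S)
    ⟨_, hmono⟩
  have hk1 : RingHom.ker (φ ^ k) = RingHom.ker (φ ^ (k + 1)) := hk (k + 1) (Nat.le_succ k)
  have hsurj : Function.Surjective (φ ^ k) := by
    rw [RingHom.coe_pow]
    exact hφ.iterate k
  rw [injective_iff_map_eq_zero]
  intro z hz
  obtain ⟨w, rfl⟩ := hsurj z
  have : w ∈ RingHom.ker (φ ^ (k + 1)) := by
    rw [RingHom.mem_ker, pow_succ', RingHom.mul_def, RingHom.comp_apply, hz]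
  rw [← hk1] at this
  exact this

theorem isRegularMod_span_X (i : Fin n) :
    IsRegularMod (Ideal.span ((X : Fin n → MvPolynomial (Fin n) K) '' {m | m < i})) (X i) := by
  classical
  intro z hz
  rw [mem_ideal_span_X_image] at hz ⊢
  intro m hm
  have : Finsupp.single i 1 + m ∈ (X i * z).support := by
    rw [mem_support_iff, coeff_X_mul]
    exact mem_support_iff.1 hm
  obtain ⟨k, hk, hk'⟩ := hz _ this
  refine ⟨k, hk, ?_⟩
  have hne : i ≠ k := (ne_of_lt hk).symm
  simpa [Finsupp.single_apply, hne] using hk'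

/-- Extension of a finite family by zero. -/
def extendZero {S : Type*} [Zero S] (b : Fin n → S) (i : ℕ) : S :=
  if h : i < n then b ⟨i, h⟩ else 0

theorem extendZero_of_lt {S : Type*} [Zero S] (b : Fin n → S) {i : ℕ} (h : i < n) :
    extendZero b i = b ⟨i, h⟩ := dif_pos h

/-- Linear forms that span the space of linear forms form a regular sequence. -/
theorem isRegularMod_of_span_linearForms (b : Fin n → MvPolynomial (Fin n) K)
    (hb : ∀ i, X i ∈ Submodule.span K (Set.range b)) :
    ∀ i < n, IsRegularMod (mixedIdeal (extendZero b) 0 i 0) (extendZero b i) := by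
  intro i hi
  -- This substitution is surjective, hence an automorphism, and carries the regular sequence of
  -- variables to `b`.
  let φ : MvPolynomial (Fin n) K →ₐ[K] MvPolynomial (Fin n) K := aeval b
  have hφX : ∀ i, φ (X i) = b i := fun i => aeval_X b i
  have hsurj : Function.Surjective φ := by
    rw [← AlgHom.range_eq_top, eq_top_iff, ← adjoin_range_X, Algebra.adjoin_le_iff]
    rintro _ ⟨i, rfl⟩
    have : Submodule.span K (Set.range b) ≤ Subalgebra.toSubmodule φ.range := by
      rw [Submodule.span_le]
      rintro _ ⟨m, rfl⟩
      exact ⟨X m, hφX m⟩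
    exact this (hb i)
  have hinj : Function.Injective φ :=
    injective_of_surjective_of_isNoetherianRing φ.toRingHom hsurj
  have hJ : mixedIdeal (extendZero b) 0 i 0 =
      (Ideal.span ((X : Fin n → MvPolynomial (Fin n) K) '' {m | m < ⟨i, hi⟩})).map φ := by
    rw [mixedIdeal, Ideal.map_span]
    congr 1
    ext z
    simp only [Set.mem_union, Set.mem_image, Set.mem_Iio, Nat.not_lt_zero, false_and,
      exists_false, or_false, Set.mem_ofPred_eq, Fin.lt_def]
    constructor
    · rintro ⟨m, hm, rfl⟩
      exact ⟨_, ⟨⟨m, by omega⟩, hm, rfl⟩, by rw [hφX, extendZero_of_lt]⟩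
    · rintro ⟨_, ⟨m, hm, rfl⟩, rfl⟩
      exact ⟨m, hm, by rw [hφX, extendZero_of_lt _ m.2]⟩
  rw [hJ, extendZero_of_lt _ hi]
  intro z hz
  obtain ⟨w, rfl⟩ := hsurj z
  rw [← hφX, ← map_mul, Ideal.mem_map_iff_of_surjective φ hsurj] at hz
  obtain ⟨u, hu, hu'⟩ := hz
  rw [hinj hu'] at hu
  exact Ideal.mem_map_of_mem φ (isRegularMod_span_X _ _ hu)

end Coordinates

/-! ### Homogeneous components -/

section Homogeneous

variable {K : Type*} [Field K] {σ : Type*}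

attribute [local instance] MvPolynomial.gradedAlgebra

/-- Closure of an ideal under taking homogeneous components. -/
def IsHomogeneousIdeal (J : Ideal (MvPolynomial σ K)) : Prop :=
  ∀ p ∈ J, ∀ d, homogeneousComponent d p ∈ J

theorem isHomogeneousIdeal_span {s : Set (MvPolynomial σ K)}
    (hs : ∀ p ∈ s, ∃ d, p.IsHomogeneous d) : IsHomogeneousIdeal (Ideal.span s) :=
  fun _ hp d => homogeneousComponent_mem_of_mem
    (Ideal.homogeneous_span (homogeneousSubmodule σ K) s fun p hp => hs p hp) hp d

theorem homogeneousComponent_mul_of_isHomogeneous {a : MvPolynomial σ K} {e : ℕ}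
    (ha : a.IsHomogeneous e) (w : MvPolynomial σ K) (d : ℕ) :
    homogeneousComponent (e + d) (a * w) = a * homogeneousComponent d w := by
  have := DirectSum.coe_decompose_mul_add_of_left_mem (homogeneousSubmodule σ K)
    (i := e) (j := d) (a := a) (b := w) ha
  simpa [← decomposition.decompose'_apply] using this

theorem homogeneousComponent_mul_of_lt {a : MvPolynomial σ K} {e : ℕ}
    (ha : a.IsHomogeneous e) (w : MvPolynomial σ K) {d : ℕ} (hd : d < e) :
    homogeneousComponent d (a * w) = 0 := by
  classical
  have := DirectSum.coe_decompose_mul_of_left_mem_of_not_le (homogeneousSubmodule σ K)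
    (i := e) (n := d) (a := a) (b := w) ha (by omega)
  simpa [← decomposition.decompose'_apply] using this

end Homogeneous

/-! ### Trading quadrics for linear forms -/

section Annihilator

variable {K : Type*} [Field K] {σ : Type*}

/-- Elements annihilated by `y 0, …, y (k - 1)` modulo `mixedIdeal y h i (n - i)` are linearly
dependent in low degrees: replacing the quadric `h j` by the linear form `y i` embeds the
annihilator in degree `d + 1` into the one in degree `d`. -/
theorem exists_linear_combination_mem_mixedIdeal {y h : ℕ → MvPolynomial σ K} {n k : ℕ}
    (hkn : k ≤ n) (hy : ∀ m, (y m).IsHomogeneous 1) (hh : ∀ m, (h m).IsHomogeneous 2)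
    (h1 : ∀ i j, i + j < n → IsRegularMod (mixedIdeal y h i j) (y i))
    (h2 : ∀ i j, i + j < n → IsRegularMod (mixedIdeal y h i j) (h j)) :
    ∀ t i, i + t = k → ∀ d r, (d < t ∨ (d = t ∧ 1 ≤ r)) →
      ∀ s : Fin (r + 1) → MvPolynomial σ K, (∀ a, (s a).IsHomogeneous d) →
      (∀ a, ∀ m < k, y m * s a ∈ mixedIdeal y h i (n - i)) →
      ∃ c : Fin (r + 1) → K, c ≠ 0 ∧ ∑ a, c a • s a ∈ mixedIdeal y h i (n - i) := by
  have hJ : ∀ i j, IsHomogeneousIdeal (mixedIdeal y h i j) := fun i j =>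
    isHomogeneousIdeal_span fun p hp => by
      rcases hp with ⟨m, -, rfl⟩ | ⟨m, -, rfl⟩
      exacts [⟨1, hy m⟩, ⟨2, hh m⟩]
  intro t
  induction t with
  | zero =>
    intro i hi d r hdr s hs _
    -- All trades are done: only constants remain, and two or more scalars are dependent.
    obtain ⟨rfl, hr⟩ : d = 0 ∧ 1 ≤ r := by omega
    have hs0 : ∀ a, ∃ α : K, s a = C α := fun a =>
      ⟨_, (totalDegree_eq_zero_iff_eq_C.1 (Nat.le_zero.1 (hs a).totalDegree_le))⟩
    choose α hα using hs0
    have hdep : ¬ LinearIndependent K α := fun hli => by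
      have := hli.fintype_card_le_finrank
      simp at this
      omega
    rw [Fintype.not_linearIndependent_iff] at hdep
    obtain ⟨c, hc, a, ha⟩ := hdep
    refine ⟨c, fun h0 => ha (by rw [h0]; rfl), ?_⟩
    have : ∑ a, c a • s a = C (∑ a, c a • α a) := by
      rw [map_sum]
      exact Finset.sum_congr rfl fun a _ => by rw [hα, smul_eq_C_mul, smul_eq_mul, C_mul]
    rw [this, hc, C_0]
    exact zero_mem _
  | succ t ih =>
    intro i hi d r hdr s hs hann
    obtain ⟨j, hj⟩ : ∃ j, n - i = j + 1 := ⟨n - i - 1, by omega⟩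
    have hj' : n - (i + 1) = j := by omega
    have hij : i + j < n := by omega
    rw [hj] at hann ⊢
    -- The embedding is `s ↦ w`, where `y_i s = h_j w` modulo the smaller ideal; the degree drops by
    -- `2 - 1`.
    have hex : ∀ a, ∃ w, y i * s a - h j * w ∈ mixedIdeal y h i j := fun a => by
      have := hann a i (by omega)
      rwa [mixedIdeal_succ_right, mem_sup_span_singleton] at this
    choose w hw using hex
    -- If the degree reaches 0 before the trades run out, `y_i s` is linear and cannot involve
    -- `h_j`, so `s` itself vanishes modulo the ideal.
    rcases d with _ | d
    · refine ⟨Pi.single 0 1, fun h0 => one_ne_zero (α := K) (by simpa using congrFun h0 0), ?_⟩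
      have hcomp := hJ i j _ (hw 0) 1
      have hys : (y i * s 0).IsHomogeneous 1 := (hy i).mul (hs 0)
      rw [map_sub, homogeneousComponent_mul_of_lt (hh j) _ (by norm_num), sub_zero,
        homogeneousComponent_eq_self hys] at hcomp
      have : ∑ a, (Pi.single 0 1 : Fin (r + 1) → K) a • s a = s 0 := by
        rw [Finset.sum_eq_single 0 (fun b _ hb => by simp [hb]) (by simp)]
        simp
      rw [this, mixedIdeal_succ_right]
      exact Ideal.mem_sup_left (h1 i j hij _ hcomp)
    · have hv : ∀ a, y i * s a - h j * homogeneousComponent d (w a) ∈ mixedIdeal y h i j := by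
        intro a
        have hcomp := hJ i j _ (hw a) (2 + d)
        have hys : (y i * s a).IsHomogeneous (2 + d) := by
          have := (hy i).mul (hs a)
          rwa [show 1 + (d + 1) = 2 + d by ring] at this
        rwa [map_sub, homogeneousComponent_mul_of_isHomogeneous (hh j),
          homogeneousComponent_eq_self hys] at hcomp
      obtain ⟨c, hc, hcm⟩ := ih (i + 1) (by omega) d r (by omega)
        (fun a => homogeneousComponent d (w a))
        (fun a => homogeneousComponent_isHomogeneous d (w a)) (fun a m hm => by
          rw [hj', mixedIdeal_succ_left, mem_sup_span_singleton]
          have hms := hann a m hm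
          rw [mixedIdeal_succ_right, mem_sup_span_singleton] at hms
          obtain ⟨u, hu⟩ := hms
          refine ⟨u, h2 i j hij _ ?_⟩
          -- Cancelling `h_j` shows that `y_m` still kills `w` once `y_i` is adjoined.
          have e : h j * (y m * homogeneousComponent d (w a) - y i * u) =
              y i * (y m * s a - h j * u) -
                y m * (y i * s a - h j * homogeneousComponent d (w a)) := by ring
          rw [e]
          exact sub_mem (Ideal.mul_mem_left _ _ hu) (Ideal.mul_mem_left _ _ (hv a)))
      refine ⟨c, hc, ?_⟩
      rw [hj', mixedIdeal_succ_left, mem_sup_span_singleton] at hcm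
      obtain ⟨u, hu⟩ := hcm
      rw [mixedIdeal_succ_right, mem_sup_span_singleton]
      refine ⟨u, h1 i j hij _ ?_⟩
      -- Injectivity: cancelling `y_i` lifts the relation among the `w a` back to the `s a`.
      have e : y i * (∑ a, c a • s a - h j * u) =
          ∑ a, c a • (y i * s a - h j * homogeneousComponent d (w a)) +
            h j * (∑ a, c a • homogeneousComponent d (w a) - y i * u) := by
        simp only [smul_sub, Finset.sum_sub_distrib, mul_sub, Finset.mul_sum, mul_smul_comm]
        ring
      rw [e]
      exact add_mem (sum_mem fun a _ => Submodule.smul_of_tower_mem _ _ (hv a))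
        (Ideal.mul_mem_left _ _ hu)

theorem one_notMem_mixedIdeal {y h : ℕ → MvPolynomial σ K}
    (hy : ∀ m, (y m).IsHomogeneous 1) (hh : ∀ m, (h m).IsHomogeneous 2) (i j : ℕ) :
    (1 : MvPolynomial σ K) ∉ mixedIdeal y h i j := by
  intro h1
  have hle : mixedIdeal y h i j ≤ RingHom.ker (constantCoeff (R := K) (σ := σ)) := by
    rw [mixedIdeal, Ideal.span_le]
    rintro p (⟨m, -, rfl⟩ | ⟨m, -, rfl⟩)
    · exact (hy m).coeff_eq_zero (d := 0) (by simp)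
    · exact (hh m).coeff_eq_zero (d := 0) (by simp)
  have := hle h1
  simp [RingHom.mem_ker] at this

end Annihilator

/-! ### Independence of generic quadrics and bases of linear forms -/

section LinearForms

variable {K : Type*} [Field K] {n : ℕ}

/-- If `h j` were a combination of its predecessors, its regularity would put `1` in the proper
ideal they generate. -/
theorem linearIndependent_of_isRegularMod {y h : ℕ → MvPolynomial (Fin n) K}
    (hy : ∀ m, (y m).IsHomogeneous 1) (hh : ∀ m, (h m).IsHomogeneous 2) (j : ℕ)
    (h2 : ∀ m < j, IsRegularMod (mixedIdeal y h 0 m) (h m)) :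
    LinearIndependent K fun m : Fin j => h m := by
  induction j with
  | zero => exact linearIndependent_empty_type
  | succ j ih =>
    rw [linearIndependent_finSucc']
    refine ⟨ih fun m hm => h2 m (by omega), fun hmem => ?_⟩
    refine one_notMem_mixedIdeal hy hh 0 j (h2 j (by omega) 1 ?_)
    rw [mul_one]
    have hle : Submodule.span K (Set.range (Fin.init fun m : Fin (j + 1) => h m)) ≤
        (mixedIdeal y h 0 j).restrictScalars K := by
      rw [Submodule.span_le]
      rintro _ ⟨m, rfl⟩
      exact Ideal.subset_span (Or.inr ⟨m, m.2, rfl⟩)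
    simpa using hle hmem

theorem finrank_homogeneousSubmodule_one :
    Module.finrank K (homogeneousSubmodule (Fin n) K 1) = n := by
  rw [homogeneousSubmodule_one_eq_span_X, finrank_span_eq_card, Fintype.card_fin]
  exact (linearIndependent_X (Fin n) K)

instance finite_homogeneousSubmodule (d : ℕ) :
    Module.Finite K (homogeneousSubmodule (Fin n) K d) :=
  Module.Finite.of_fg (homogeneousSubmodule_fg _ _ d)

/-- A linearly independent family of linear forms extends to a basis of the linear forms. -/
theorem exists_extension_linearForms {k : ℕ} (b : Fin k → MvPolynomial (Fin n) K)
    (hb : ∀ i, (b i).IsHomogeneous 1) (hli : LinearIndependent K b) :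
    ∃ (_ : k ≤ n) (b' : Fin n → MvPolynomial (Fin n) K), (∀ i, (b' i).IsHomogeneous 1) ∧
      (∀ i, X i ∈ Submodule.span K (Set.range b')) ∧
      ∀ i : Fin k, extendZero b' i = b i := by
  let H := homogeneousSubmodule (Fin n) K 1
  let b₁ : Fin k → H := fun i => ⟨b i, hb i⟩
  have hli₁ : LinearIndependent K b₁ := LinearIndependent.of_comp H.subtype hli
  have hkn : k ≤ n := by
    have := hli₁.fintype_card_le_finrank
    rwa [Fintype.card_fin, finrank_homogeneousSubmodule_one] at this
  let B := Module.Basis.sumExtend hli₁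
  have hfin : Finite (Fin k ⊕ Module.Basis.sumExtendIndex hli₁) :=
    Module.Finite.finite_basis B
  have : Finite (Module.Basis.sumExtendIndex hli₁) := Finite.of_injective (β := Fin k ⊕ Module.Basis.sumExtendIndex hli₁) _ Sum.inr_injective
  have := Fintype.ofFinite (Module.Basis.sumExtendIndex hli₁)
  have hcard : Fintype.card (Module.Basis.sumExtendIndex hli₁) = n - k := by
    have := Module.finrank_eq_card_basis B
    rw [finrank_homogeneousSubmodule_one, Fintype.card_sum, Fintype.card_fin] at this
    omega
  let e : Fin k ⊕ Module.Basis.sumExtendIndex hli₁ ≃ Fin n :=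
    ((Equiv.refl _).sumCongr (Fintype.equivFinOfCardEq hcard)).trans
      (finSumFinEquiv.trans (finCongr (by omega)))
  refine ⟨hkn, fun i => (B.reindex e i : MvPolynomial (Fin n) K), fun i => (B.reindex e i).2,
    fun i => ?_, fun i => ?_⟩
  · have h1 : (⟨X i, isHomogeneous_X K i⟩ : H) ∈ Submodule.span K (Set.range (B.reindex e)) := by
      rw [(B.reindex e).span_eq]; trivial
    have h2 := Submodule.mem_map_of_mem (f := H.subtype) h1
    rw [Submodule.map_span, ← Set.range_comp] at h2
    exact h2
  · have hi : (i : ℕ) < n := by omega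
    have he : e (Sum.inl i) = ⟨i, hi⟩ := by
      ext; simp [e]
    rw [extendZero_of_lt _ hi, ← he, Module.Basis.reindex_apply, Equiv.symm_apply_apply]
    have : B (Sum.inl i) = b₁ i := by
      simp only [B, Module.Basis.sumExtend]
      simp
      rfl
    rw [this]

end LinearForms

/-! ### The annihilator bound in the quotient -/

section Quotient

variable {K : Type*} [Field K] {n : ℕ}

/-- The ideal of the `f i` is also generated by `n` generic quadrics from their span, so the trading
argument applies starting from `i = 0`. -/
theorem exists_linear_combination_mem [Infinite K] (f : Fin n → MvPolynomial (Fin n) K)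
    (hf : ∀ i, (f i).IsHomogeneous 2) (hfli : LinearIndependent K f) {N : ℕ}
    (hN : ∀ p : MvPolynomial (Fin n) K, p.IsHomogeneous N → p ∈ Ideal.span (Set.range f))
    {k : ℕ} (b : Fin k → MvPolynomial (Fin n) K) (hb : ∀ i, (b i).IsHomogeneous 1)
    (hbli : LinearIndependent K b) {d r : ℕ} (hdr : d < k ∨ (d = k ∧ 1 ≤ r))
    (s : Fin (r + 1) → MvPolynomial (Fin n) K) (hs : ∀ a, (s a).IsHomogeneous d)
    (hann : ∀ a m, b m * s a ∈ Ideal.span (Set.range f)) :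
    ∃ c : Fin (r + 1) → K, c ≠ 0 ∧ ∑ a, c a • s a ∈ Ideal.span (Set.range f) := by
  obtain ⟨hkn, b', hb'1, hb'X, hb'b⟩ := exists_extension_linearForms b hb hbli
  have hy : ∀ m, (extendZero b' m).IsHomogeneous 1 := fun m => by
    rw [extendZero]
    split_ifs with h
    exacts [hb'1 _, isHomogeneous_zero _ _ _]
  have hF2 : Submodule.span K (Set.range f) ≤ homogeneousSubmodule (Fin n) K 2 := by
    rw [Submodule.span_le]
    rintro _ ⟨i, rfl⟩
    exact hf i
  obtain ⟨h, hhF, h1, h2⟩ := exists_generic_sequence (Submodule.span K (Set.range f)) n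
    (extendZero b') (isRegularMod_of_span_linearForms b' hb'X) (fun P hP hPF i => by
      -- A prime containing the `f i` contains every form of degree `N`, in particular the `N`-th
      -- power of each `y i`.
      have hle : Ideal.span (Set.range f) ≤ P :=
        Ideal.span_le.2 fun p hp => hPF (Submodule.subset_span hp)
      refine hP.mem_of_pow_mem N (hle (hN _ ?_))
      simpa using (hy i).pow N) n
  have hh : ∀ m, (h m).IsHomogeneous 2 := fun m => hF2 (hhF m)
  have : Module.Finite K (Submodule.span K (Set.range f)) :=
    Module.Finite.span_of_finite K (Set.finite_range f)
  have hspan : Submodule.span K (Set.range fun m : Fin n => h m) =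
      Submodule.span K (Set.range f) := by
    refine Submodule.eq_of_le_of_finrank_eq ?_ ?_
    · rw [Submodule.span_le]
      rintro _ ⟨m, rfl⟩
      exact hhF m
    · rw [finrank_span_eq_card hfli, finrank_span_eq_card
        (linearIndependent_of_isRegularMod hy hh n fun m hm => h2 0 m (by omega) hm)]
  have hideal : mixedIdeal (extendZero b') h 0 n = Ideal.span (Set.range f) := by
    refine le_antisymm ?_ ?_
    · rw [mixedIdeal, Ideal.span_le]
      rintro p (⟨m, hm, rfl⟩ | ⟨m, hm, rfl⟩)
      · exact absurd hm (by simp)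
      · exact Submodule.span_le_restrictScalars K _ _ (hhF m)
    · rw [Ideal.span_le]
      intro p hp
      have : p ∈ Submodule.span K (Set.range fun m : Fin n => h m) := by
        rw [hspan]; exact Submodule.subset_span hp
      refine (Submodule.span_le.2 ?_ : _ ≤ (mixedIdeal (extendZero b') h 0 n).restrictScalars K) this
      rintro _ ⟨m, rfl⟩
      exact Ideal.subset_span (Or.inr ⟨m, m.2, rfl⟩)
  have := exists_linear_combination_mem_mixedIdeal hkn hy hh
    (fun i j hij => h1 i j hij (by omega)) (fun i j hij => h2 i j hij (by omega))
    k 0 (by omega) d r hdr s hs (fun a m hm => by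
      rw [Nat.sub_zero, hideal]
      have := hb'b ⟨m, hm⟩
      simp only at this
      rw [this]
      exact hann a _)
  rwa [Nat.sub_zero, hideal] at this

theorem mem_gradedPiece {I : Ideal (MvPolynomial (Fin n) K)} {d : ℕ}
    {a : MvPolynomial (Fin n) K ⧸ I} :
    a ∈ gradedPiece I d ↔ ∃ p : MvPolynomial (Fin n) K, p.IsHomogeneous d ∧
      Ideal.Quotient.mk I p = a := Iff.rfl

instance finite_gradedPiece (I : Ideal (MvPolynomial (Fin n) K)) (d : ℕ) :
    Module.Finite K (gradedPiece I d) := by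
  rw [gradedPiece]
  infer_instance

theorem finrank_le_of_mul_eq_zero [Infinite K] (f : Fin n → MvPolynomial (Fin n) K)
    (hf : ∀ i, (f i).IsHomogeneous 2) (hfli : LinearIndependent K f) {N : ℕ}
    (hN : ∀ p : MvPolynomial (Fin n) K, p.IsHomogeneous N → p ∈ Ideal.span (Set.range f))
    {L U : Submodule K (MvPolynomial (Fin n) K ⧸ Ideal.span (Set.range f))} {d r : ℕ}
    (hL : L ≤ gradedPiece _ 1) (hU : U ≤ gradedPiece _ d) (hLU : ∀ l ∈ L, ∀ u ∈ U, l * u = 0)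
    (hdr : d < Module.finrank K L ∨ (d = Module.finrank K L ∧ 1 ≤ r)) :
    Module.finrank K U ≤ r := by
  have hLfin : Module.Finite K L := Submodule.finiteDimensional_of_le hL
  have hUfin : Module.Finite K U := Submodule.finiteDimensional_of_le hU
  by_contra! hlt
  obtain ⟨u, hu⟩ : ∃ u : Fin (r + 1) → U, LinearIndependent K u :=
    exists_linearIndependent_of_le_finrank hlt
  let l := Module.finBasis K L
  choose b hb hbl using fun i => mem_gradedPiece.1 (hL (l i).2)
  choose s hs hsu using fun a => mem_gradedPiece.1 (hU (u a).2)
  have hbli : LinearIndependent K b := by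
    refine LinearIndependent.of_comp (Ideal.Quotient.mkₐ K (Ideal.span (Set.range f))).toLinearMap ?_
    have : ⇑(Ideal.Quotient.mkₐ K (Ideal.span (Set.range f))).toLinearMap ∘ b =
        L.subtype ∘ l := funext hbl
    rw [this]
    exact l.linearIndependent.map' _ (Submodule.ker_subtype L)
  obtain ⟨c, hc, hcm⟩ := exists_linear_combination_mem f hf hfli hN b hb hbli hdr s hs
    (fun a m => by
      rw [← Ideal.Quotient.eq_zero_iff_mem, map_mul, hbl, hsu]
      exact hLU _ (l m).2 _ (u a).2)
  apply hc
  have h0 : ∑ a, c a • u a = 0 := by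
    apply Subtype.ext
    rw [← Ideal.Quotient.eq_zero_iff_mem, ← Ideal.Quotient.mkₐ_eq_mk K, map_sum] at hcm
    simp only [map_smul, Ideal.Quotient.mkₐ_eq_mk, hsu] at hcm
    simpa using hcm
  exact funext fun a => Fintype.linearIndependent_iff.1 hu c h0 a

end Quotient

/-! ### Lower bounds for products with linear forms -/

section Products

variable {K A : Type*} [Field K] [CommRing A] [Algebra K A]

theorem finrank_map_add_finrank_inf_ker {M N : Type*} [AddCommGroup M] [Module K M]
    [AddCommGroup N] [Module K N] (φ : M →ₗ[K] N) (S : Submodule K M) [Module.Finite K S] :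
    Module.finrank K (S.map φ) + Module.finrank K (S ⊓ LinearMap.ker φ : Submodule K M) =
      Module.finrank K S := by
  have h := LinearMap.finrank_range_add_finrank_ker (φ.domRestrict S)
  rw [LinearMap.range_domRestrict] at h
  have e : S ⊓ LinearMap.ker φ = (LinearMap.ker (φ.domRestrict S)).map S.subtype := by
    ext x
    simp [and_comm]
  rw [← h, e, Submodule.finrank_map_subtype_eq]

instance finite_mul (X V : Submodule K A) [Module.Finite K X] [Module.Finite K V] :
    Module.Finite K (X * V : Submodule K A) :=
  Module.Finite.of_fg ((Module.Finite.iff_fg.1 ‹_›).mul (Module.Finite.iff_fg.1 ‹_›))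

theorem finrank_ne_zero_iff {S : Submodule K A} [Module.Finite K S] :
    Module.finrank K S ≠ 0 ↔ ∃ x ∈ S, x ≠ 0 := by
  rw [Ne, Submodule.finrank_eq_zero, ← Ne, Submodule.ne_bot_iff]

/-- Over an algebraically closed field, a multiplication map `X × V → X * V` with small image
has a nontrivial zero. -/
theorem exists_mul_eq_zero_of_finrank_mul_le [IsAlgClosed K] (X V : Submodule K A)
    [Module.Finite K X] [Module.Finite K V] (hX : Module.finrank K X ≠ 0)
    (hV : 2 ≤ Module.finrank K V)
    (h : Module.finrank K (X * V : Submodule K A) ≤ Module.finrank K X) :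
    ∃ x ∈ X, x ≠ 0 ∧ ∃ v ∈ V, v ≠ 0 ∧ x * v = 0 := by
  obtain ⟨v, hv⟩ := exists_linearIndependent_of_le_finrank hV
  by_cases hinj : ∃ x ∈ X, x ≠ 0 ∧ x * v 1 = 0
  · obtain ⟨x, hx, hx0, hxv⟩ := hinj
    exact ⟨x, hx, hx0, v 1, (v 1).2, fun h0 => hv.ne_zero 1 (Subtype.ext h0), hxv⟩
  push Not at hinj
  let φ : Fin 2 → X →ₗ[K] (X * V : Submodule K A) := fun i =>
    ((LinearMap.mulRight K (v i : A)).comp X.subtype).codRestrict _ fun x =>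
      Submodule.mul_mem_mul x.2 (v i).2
  have hφ : ∀ i x, (φ i x : A) = x * v i := fun i x => rfl
  have hφ1 : Function.Injective (φ 1) := by
    rw [injective_iff_map_eq_zero]
    intro x hx
    by_contra hx0
    refine hinj x x.2 (fun h0 => hx0 (Subtype.ext h0)) ?_
    rw [← hφ, hx]; rfl
  have hrank : Module.finrank K X = Module.finrank K (X * V : Submodule K A) :=
    le_antisymm (LinearMap.finrank_le_finrank_of_injective hφ1) h
  let e : X ≃ₗ[K] (X * V : Submodule K A) := LinearEquiv.ofInjectiveOfFinrankEq (φ 1) hφ1 hrank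
  have he : ∀ x, e x = φ 1 x := fun x => rfl
  have : Nontrivial X := Module.nontrivial_of_finrank_pos (Nat.pos_of_ne_zero hX)
  -- Multiplication by `v 1` is now bijective onto `X * V`; an eigenvector `x` of its inverse
  -- composed with multiplication by `v 0` satisfies `x (v 0 - μ v 1) = 0`.
  obtain ⟨μ, hμ⟩ := Module.End.exists_eigenvalue (e.symm.toLinearMap ∘ₗ φ 0)
  obtain ⟨x, hx⟩ := hμ.exists_hasEigenvector
  have hx1 : φ 0 x = μ • φ 1 x := by
    have h' : e (e.symm (φ 0 x)) = e (μ • x) := congrArg e hx.apply_eq_smul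
    rwa [e.apply_symm_apply, map_smul, he] at h'
  refine ⟨x, x.2, fun h0 => hx.2 (Subtype.ext h0), v 0 - μ • v 1,
    (v 0 - μ • v 1).2, fun h0 => ?_, ?_⟩
  · have h0' : (1 : K) • v 0 + (-μ) • v 1 = 0 := by
      apply Subtype.ext
      simpa [sub_eq_add_neg] using h0
    have := LinearIndependent.pair_iff.1 (by
      have : v = ![v 0, v 1] := by ext i; fin_cases i <;> rfl
      rwa [this] at hv) _ _ h0'
    exact one_ne_zero this.1
  · have := congrArg Subtype.val hx1
    rw [Submodule.coe_smul, hφ, hφ] at this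
    rw [mul_sub, this, mul_smul_comm, sub_self]

/-- The properties of the graded pieces `D d` of an Artinian complete intersection of five quadrics
that are needed here: spaces of linear forms have small annihilators. -/
structure HasSmallAnnihilators (D : ℕ → Submodule K A) : Prop where
  finite : ∀ d, Module.Finite K (D d)
  mul_mem : ∀ {i j a b}, a ∈ D i → b ∈ D j → a * b ∈ D (i + j)
  finrank_one : Module.finrank K (D 1) = 5
  eq_bot : D 6 = ⊥
  finrank_le : ∀ (L U : Submodule K A) (d r : ℕ), L ≤ D 1 → U ≤ D d →
    (∀ l ∈ L, ∀ u ∈ U, l * u = 0) →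
    (d < Module.finrank K L ∨ (d = Module.finrank K L ∧ 1 ≤ r)) → Module.finrank K U ≤ r

namespace HasSmallAnnihilators

variable {D : ℕ → Submodule K A}

theorem eq_zero_of_mul_eq_zero (hD : HasSmallAnnihilators D) {L : Submodule K A} (hL : L ≤ D 1)
    {d : ℕ} {u : A} (hu : u ∈ D d) (hLu : ∀ l ∈ L, l * u = 0) (hd : d < Module.finrank K L) :
    u = 0 := by
  have h := hD.finrank_le L (K ∙ u) d 0 hL (by simpa using hu) (fun l hl v hv => by
    obtain ⟨c, rfl⟩ := Submodule.mem_span_singleton.1 hv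
    rw [mul_smul_comm, hLu l hl, smul_zero]) (Or.inl hd)
  rw [Nat.le_zero, Submodule.finrank_eq_zero, Submodule.span_singleton_eq_bot] at h
  exact h

/-- More than `d` independent linear forms cannot kill a nonzero element of degree `d`, so
multiplication by `g` has kernel of dimension at most `d` on `D 1`. -/
theorem five_le_finrank_mul_span (hD : HasSmallAnnihilators D) {d : ℕ} {g : A} (hg : g ∈ D d)
    (hg0 : g ≠ 0) : 5 ≤ Module.finrank K (D 1 * (K ∙ g) : Submodule K A) + d := by
  have := hD.finite 1
  have h := finrank_map_add_finrank_inf_ker (LinearMap.mulRight K g) (D 1)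
  rw [hD.finrank_one] at h
  have hle : (D 1).map (LinearMap.mulRight K g) ≤ D 1 * (K ∙ g) := by
    rintro _ ⟨l, hl, rfl⟩
    exact Submodule.mul_mem_mul hl (Submodule.mem_span_singleton_self g)
  have hle' := Submodule.finrank_mono hle
  have : Module.finrank K (D 1 ⊓ LinearMap.ker (LinearMap.mulRight K g) : Submodule K A) ≤ d := by
    by_contra! hlt
    exact hg0 (hD.eq_zero_of_mul_eq_zero inf_le_left hg (fun l hl => hl.2) hlt)
  omega

theorem finrank_five_le (hD : HasSmallAnnihilators D) : Module.finrank K (D 5) ≤ 1 :=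
  hD.finrank_le (D 1) (D 5) 5 1 le_rfl le_rfl (fun l hl u hu => by
    have : l * u ∈ D 6 := hD.mul_mem hl hu
    rwa [hD.eq_bot, Submodule.mem_bot] at this) (Or.inr ⟨hD.finrank_one.symm, le_rfl⟩)

/-- If `M = D 1 * U` had dimension at most 2, then since `dim D 5 ≤ 1` the linear forms killing `M`
would have dimension at least `5 - 2 = 3`. For such `l`, all of `D 1` kills `l U ⊆ D 4`, so `l U =
0`, and the annihilator bound in degree 3 gives `dim U ≤ 1`. -/
theorem three_le_finrank_mul (hD : HasSmallAnnihilators D) {U : Submodule K A} (hU : U ≤ D 3)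
    (hU2 : 2 ≤ Module.finrank K U) : 3 ≤ Module.finrank K (D 1 * U : Submodule K A) := by
  by_contra! hlt
  have := hD.finite 1
  have := hD.finite 3
  have := hD.finite 5
  have hUfin : Module.Finite K U := Submodule.finiteDimensional_of_le hU
  set M : Submodule K A := D 1 * U with hM
  have hM4 : ∀ m ∈ M, m ∈ D 4 := fun m hm =>
    (Submodule.mul_le.2 fun l hl u hu => hD.mul_mem hl (hU hu) : M ≤ D 4) hm
  let Ψ : D 1 →ₗ[K] M →ₗ[K] D 5 := LinearMap.mk₂ K
    (fun l m => ⟨l * m, hD.mul_mem l.2 (hM4 m m.2)⟩)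
    (fun l l' m => by ext; simp [add_mul]) (fun c l m => by ext; simp)
    (fun l m m' => by ext; simp [mul_add]) (fun c l m => by ext; simp)
  have hrank := LinearMap.finrank_range_add_finrank_ker (V := D 1) (V₂ := M →ₗ[K] D 5) Ψ
  have hrange := Submodule.finrank_le (LinearMap.range Ψ)
  rw [Module.finrank_linearMap] at hrange
  have hprod : Module.finrank K M * Module.finrank K (D 5) ≤ 2 * 1 :=
    Nat.mul_le_mul (by omega) hD.finrank_five_le
  rw [hD.finrank_one] at hrank
  let L : Submodule K A := (LinearMap.ker Ψ).map (D 1).subtype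
  have hL1 : L ≤ D 1 := Submodule.map_subtype_le _ _
  have hLrank : 3 ≤ Module.finrank K L := by
    rw [Submodule.finrank_map_subtype_eq]
    omega
  have hLM : ∀ l ∈ L, ∀ m ∈ M, l * m = 0 := by
    rintro _ ⟨l, hl, rfl⟩ m hm
    exact congrArg Subtype.val (LinearMap.congr_fun (LinearMap.mem_ker.1 hl) ⟨m, hm⟩)
  have hLU : ∀ l ∈ L, ∀ u ∈ U, l * u = 0 := fun l hl u hu =>
    hD.eq_zero_of_mul_eq_zero le_rfl (hD.mul_mem (hL1 hl) (hU hu)) (fun x hx => by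
      rw [mul_left_comm]
      exact hLM l hl _ (Submodule.mul_mem_mul hx hu)) (by rw [hD.finrank_one]; norm_num)
  have := hD.finrank_le L U 3 1 hL1 hU hLU (by omega)
  omega

/-- The part of `D 1 * V` killed by `l`, and its image under `l`. -/
theorem finrank_mul_add_finrank_mul_le (hD : HasSmallAnnihilators D) {V W W' : Submodule K A}
    [Module.Finite K V] {l : A} (hW : W ≤ V.map (LinearMap.mulLeft K l)) (hW' : W' ≤ V)
    (hlW' : ∀ w ∈ W', l * w = 0) :
    Module.finrank K (D 1 * W : Submodule K A) + Module.finrank K (D 1 * W' : Submodule K A) ≤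
      Module.finrank K (D 1 * V : Submodule K A) := by
  have := hD.finite 1
  have h := finrank_map_add_finrank_inf_ker (LinearMap.mulLeft K l) (D 1 * V)
  have h1 : D 1 * W ≤ (D 1 * V).map (LinearMap.mulLeft K l) := by
    refine Submodule.mul_le.2 fun x hx w hw => ?_
    obtain ⟨v, hv, rfl⟩ := hW hw
    exact ⟨x * v, Submodule.mul_mem_mul hx hv, by simp [mul_left_comm]⟩
  have h2 : D 1 * W' ≤ D 1 * V ⊓ LinearMap.ker (LinearMap.mulLeft K l) := by
    refine Submodule.mul_le.2 fun x hx w hw => ⟨Submodule.mul_mem_mul hx (hW' hw), ?_⟩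
    change l * (x * w) = 0
    rw [ mul_left_comm, hlW' w hw, mul_zero]
  have := Submodule.finrank_mono h1
  have := Submodule.finrank_mono h2
  omega

/-- Otherwise a second form `l'`, independent of `l`, kills some nonzero `g ∈ V`. The pair kills at
most a line in `V`, so `l' V` contains some `u ≠ 0`; then `D 1 * g` and `D 1 * u` contribute at
least `3 + 2`. -/
theorem five_le_finrank_mul_of_mul_eq_zero [IsAlgClosed K] (hD : HasSmallAnnihilators D)
    {V : Submodule K A} (hV : V ≤ D 2) (hV2 : 2 ≤ Module.finrank K V) {l : A} (hl : l ∈ D 1)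
    (hl0 : l ≠ 0) (hlV : ∀ v ∈ V, l * v = 0) :
    5 ≤ Module.finrank K (D 1 * V : Submodule K A) := by
  by_contra! hlt
  have := hD.finite 1
  have := hD.finite 2
  have : Module.Finite K V := Submodule.finiteDimensional_of_le hV
  obtain ⟨φ, hφ⟩ : ∃ φ : Module.Dual K A, φ l ≠ 0 := by
    by_contra! h
    exact hl0 ((Module.forall_dual_apply_eq_zero_iff K l).1 h)
  -- Searching in a hyperplane that avoids `l` ensures that `l'` is not proportional to `l`.
  let C : Submodule K A := D 1 ⊓ LinearMap.ker φ
  have hC1 : C ≤ D 1 := inf_le_left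
  have : Module.Finite K C := Submodule.finiteDimensional_of_le hC1
  have hC : 4 ≤ Module.finrank K C := by
    have h := finrank_map_add_finrank_inf_ker φ (D 1)
    have h' := Submodule.finrank_le ((D 1).map φ)
    rw [Module.finrank_self] at h'
    rw [hD.finrank_one] at h
    change _ + Module.finrank K C = 5 at h
    omega
  have hCV := Submodule.finrank_mono (mul_le_mul' hC1 (le_refl V))
  obtain ⟨l', hl', hl'0, g, hg, hg0, hlg⟩ :=
    exists_mul_eq_zero_of_finrank_mul_le C V (by omega) hV2 (by omega)
  let L : Submodule K A := Submodule.span K (Set.range ![l, l'])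
  have hLrank : Module.finrank K L = 2 := by
    rw [finrank_span_eq_card, Fintype.card_fin]
    rw [LinearIndependent.pair_iff]
    intro s t hst
    have hs : s = 0 := by
      have := congrArg φ hst
      rw [map_add, map_smul, map_smul, LinearMap.mem_ker.1 hl'.2] at this
      simpa [hφ] using this
    subst hs
    simpa [hl'0] using hst
  have hL1 : L ≤ D 1 := by
    rw [Submodule.span_le]
    rintro _ ⟨i, rfl⟩
    fin_cases i
    exacts [hl, hC1 hl']
  let U : Submodule K A := V ⊓ LinearMap.ker (LinearMap.mulLeft K l')
  have hU : Module.finrank K U ≤ 1 := by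
    refine hD.finrank_le L U 2 1 hL1 (inf_le_left.trans hV) (fun x hx u hu => ?_)
      (Or.inr ⟨hLrank.symm, le_rfl⟩)
    have hle : L ≤ LinearMap.ker (LinearMap.mulRight K u) := by
      rw [Submodule.span_le]
      rintro _ ⟨i, rfl⟩
      fin_cases i
      exacts [hlV u hu.1, hu.2]
    exact hle hx
  have hrank := finrank_map_add_finrank_inf_ker (LinearMap.mulLeft K l') V
  obtain ⟨u, hu, hu0⟩ := finrank_ne_zero_iff.1
    (show Module.finrank K (V.map (LinearMap.mulLeft K l')) ≠ 0 by
      change _ + Module.finrank K U = _ at hrank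
      omega)
  have hu3 : u ∈ D 3 := by
    obtain ⟨v, hv, rfl⟩ := hu
    exact hD.mul_mem (hC1 hl') (hV hv)
  have h1 := hD.five_le_finrank_mul_span hu3 hu0
  have h2 := hD.five_le_finrank_mul_span (hV hg) hg0
  have h3 := hD.finrank_mul_add_finrank_mul_le (V := V) (W := K ∙ u) (W' := K ∙ g) (l := l')
    (by simpa using hu) (by simpa using hg) (fun w hw => by
      obtain ⟨c, rfl⟩ := Submodule.mem_span_singleton.1 hw
      rw [mul_smul_comm, hlg, smul_zero])
  omega

/-- A three-dimensional space `V` of quadrics with no common linear annihilator generates at least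
six cubics. -/
theorem six_le_finrank_mul [IsAlgClosed K] (hD : HasSmallAnnihilators D)
    {V : Submodule K A} (hV : V ≤ D 2) (hV3 : Module.finrank K V = 3)
    (hann : ∀ l ∈ D 1, (∀ v ∈ V, l * v = 0) → l = 0) :
    6 ≤ Module.finrank K (D 1 * V : Submodule K A) := by
  by_contra! hlt
  have := hD.finite 1
  have := hD.finite 2
  have : Module.Finite K V := Submodule.finiteDimensional_of_le hV
  obtain ⟨l, hl, hl0, g, hg, hg0, hlg⟩ := exists_mul_eq_zero_of_finrank_mul_le (D 1) V
    (by rw [hD.finrank_one]; norm_num) (by omega) (by rw [hD.finrank_one]; omega)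
  have hrank := finrank_map_add_finrank_inf_ker (LinearMap.mulLeft K l) V
  have hsum := hD.finrank_mul_add_finrank_mul_le (V := V) (l := l) le_rfl
    (inf_le_left : V ⊓ LinearMap.ker (LinearMap.mulLeft K l) ≤ V) (fun w hw => hw.2)
  set V' := V ⊓ LinearMap.ker (LinearMap.mulLeft K l) with hV'
  set W := V.map (LinearMap.mulLeft K l) with hW
  have hW3 : W ≤ D 3 := by
    rintro _ ⟨v, hv, rfl⟩
    exact hD.mul_mem hl (hV hv)
  have hV'2 : V' ≤ D 2 := inf_le_left.trans hV
  have hgV' : g ∈ V' := ⟨hg, hlg⟩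
  have : Module.Finite K V' := Submodule.finiteDimensional_of_le hV'2
  have hV'0 : Module.finrank K V' ≠ 0 := finrank_ne_zero_iff.2 ⟨g, hgV', hg0⟩
  have hW0 : Module.finrank K W ≠ 0 := by
    intro h0
    rw [Submodule.finrank_eq_zero] at h0
    refine hl0 (hann l hl fun v hv => ?_)
    have : l * v ∈ W := ⟨v, hv, rfl⟩
    rwa [h0, Submodule.mem_bot] at this
  -- The contributions of `V'` and `W` are at least `3 + 3` in the first case and `5 + 2` in the
  -- second.
  rcases (by omega : Module.finrank K V' = 1 ∨ Module.finrank K V' = 2) with h1 | h2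
  · have h3 := hD.three_le_finrank_mul hW3 (by omega)
    have h4 := hD.five_le_finrank_mul_span (hV'2 hgV') hg0
    have h5 := Submodule.finrank_mono (mul_le_mul' (le_refl (D 1))
      (show (K ∙ g) ≤ V' by simpa using hgV'))
    omega
  · have h3 := hD.five_le_finrank_mul_of_mul_eq_zero hV'2 h2.ge hl hl0 fun v hv => hv.2
    obtain ⟨u, hu, hu0⟩ := finrank_ne_zero_iff.1 hW0
    have h4 := hD.five_le_finrank_mul_span (hW3 hu) hu0
    have h5 := Submodule.finrank_mono (mul_le_mul' (le_refl (D 1))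
      (show (K ∙ u) ≤ W by simpa using hu))
    omega

end HasSmallAnnihilators

end Products

/-! ### Hilbert function of a complete intersection -/

section HilbertFunction

variable {K : Type*} [Field K] {n : ℕ}

theorem finrank_homogeneousSubmodule (d : ℕ) :
    Module.finrank K (homogeneousSubmodule (Fin n) K d) = (n + d - 1).choose d := by
  have e : homogeneousSubmodule (Fin n) K d =
      restrictSupport K (Finset.univ.finsuppAntidiag d : Finset (Fin n →₀ ℕ)) := by
    rw [homogeneousSubmodule_eq_finsupp_supported]
    congr 1
    ext m
    simp [Finset.mem_finsuppAntidiag, Finsupp.degree_eq_sum]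
  rw [e, Module.finrank_eq_nat_card_basis (basisRestrictSupport K _), Nat.card_coe_set_eq,
    Set.ncard_coe_finset,
    Finset.card_finsuppAntidiag_nat_eq_choose, Finset.card_univ, Fintype.card_fin]

theorem hilbertFunction_bot (d : ℕ) :
    hilbertFunction (⊥ : Ideal (MvPolynomial (Fin n) K)) d = (n + d - 1).choose d := by
  have h := finrank_map_add_finrank_inf_ker
    (Ideal.Quotient.mkₐ K (⊥ : Ideal (MvPolynomial (Fin n) K))).toLinearMap
    (homogeneousSubmodule (Fin n) K d)
  have hbot : homogeneousSubmodule (Fin n) K d ⊓ LinearMap.ker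
      (Ideal.Quotient.mkₐ K (⊥ : Ideal (MvPolynomial (Fin n) K))).toLinearMap = ⊥ := by
    rw [eq_bot_iff]
    rintro p ⟨-, hp⟩
    exact Ideal.Quotient.eq_zero_iff_mem.1 hp
  rw [hbot, finrank_bot, add_zero, finrank_homogeneousSubmodule] at h
  exact h

theorem map_factor_gradedPiece {I J : Ideal (MvPolynomial (Fin n) K)} (hIJ : I ≤ J) (d : ℕ) :
    (gradedPiece I d).map (Ideal.Quotient.factorₐ K hIJ).toLinearMap = gradedPiece J d := by
  rw [gradedPiece, gradedPiece, ← Submodule.map_comp]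
  rfl

theorem mk_mem_ker_factor {I J : Ideal (MvPolynomial (Fin n) K)} (hIJ : I ≤ J)
    {p : MvPolynomial (Fin n) K} : Ideal.Quotient.mk I p ∈
      LinearMap.ker (Ideal.Quotient.factorₐ K hIJ).toLinearMap ↔ p ∈ J :=
  Ideal.Quotient.eq_zero_iff_mem

theorem hilbertFunction_sup_span_of_lt {J : Ideal (MvPolynomial (Fin n) K)}
    (hJ : IsHomogeneousIdeal J) {a : MvPolynomial (Fin n) K} {e : ℕ} (ha : a.IsHomogeneous e)
    {d : ℕ} (hd : d < e) : hilbertFunction (J ⊔ Ideal.span {a}) d = hilbertFunction J d := by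
  have hle : J ≤ J ⊔ Ideal.span {a} := le_sup_left
  have h := finrank_map_add_finrank_inf_ker (Ideal.Quotient.factorₐ K hle).toLinearMap
    (gradedPiece J d)
  have hker : gradedPiece J d ⊓ LinearMap.ker (Ideal.Quotient.factorₐ K hle).toLinearMap = ⊥ := by
    rw [eq_bot_iff]
    rintro _ ⟨hx, hx'⟩
    obtain ⟨p, hp, rfl⟩ := mem_gradedPiece.1 hx
    obtain ⟨w, hw⟩ := mem_sup_span_singleton.1 ((mk_mem_ker_factor hle).1 hx')
    have := hJ _ hw d
    rw [map_sub, homogeneousComponent_mul_of_lt ha w hd, sub_zero,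
      homogeneousComponent_eq_self hp] at this
    rw [Submodule.mem_bot]
    exact Ideal.Quotient.eq_zero_iff_mem.2 this
  rw [hker, finrank_bot, add_zero, map_factor_gradedPiece] at h
  exact h

/-- Multiplication by the regular form `a` identifies degree `d` of the quotient by `J` with the
kernel of the projection in degree `e + d`. -/
theorem hilbertFunction_sup_span_add {J : Ideal (MvPolynomial (Fin n) K)}
    (hJ : IsHomogeneousIdeal J) {a : MvPolynomial (Fin n) K} {e : ℕ} (ha : a.IsHomogeneous e)
    (hreg : IsRegularMod J a) (d : ℕ) :
    hilbertFunction (J ⊔ Ideal.span {a}) (e + d) + hilbertFunction J d =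
      hilbertFunction J (e + d) := by
  have hle : J ≤ J ⊔ Ideal.span {a} := le_sup_left
  have h := finrank_map_add_finrank_inf_ker (Ideal.Quotient.factorₐ K hle).toLinearMap
    (gradedPiece J (e + d))
  have hker : gradedPiece J (e + d) ⊓ LinearMap.ker (Ideal.Quotient.factorₐ K hle).toLinearMap =
      (gradedPiece J d).map (LinearMap.mulLeft K (Ideal.Quotient.mk J a)) := by
    refine le_antisymm ?_ ?_
    · rintro _ ⟨hx, hx'⟩
      obtain ⟨p, hp, rfl⟩ := mem_gradedPiece.1 hx
      obtain ⟨w, hw⟩ := mem_sup_span_singleton.1 ((mk_mem_ker_factor hle).1 hx')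
      have := hJ _ hw (e + d)
      rw [map_sub, homogeneousComponent_mul_of_isHomogeneous ha w,
        homogeneousComponent_eq_self hp] at this
      refine ⟨Ideal.Quotient.mk J (homogeneousComponent d w),
        ⟨_, homogeneousComponent_isHomogeneous d w, rfl⟩, ?_⟩
      rw [LinearMap.mulLeft_apply, ← map_mul]
      exact (Ideal.Quotient.eq.2 this).symm
    · rintro _ ⟨_, ⟨p, hp, rfl⟩, rfl⟩
      refine ⟨⟨a * p, ha.mul hp, map_mul (Ideal.Quotient.mk J) a p⟩, ?_⟩
      exact (mk_mem_ker_factor hle (p := a * p)).2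
        (Ideal.mem_sup_right (Ideal.mul_mem_right _ _ (Ideal.mem_span_singleton_self a)))
  have hinj := finrank_map_add_finrank_inf_ker (LinearMap.mulLeft K (Ideal.Quotient.mk J a))
    (gradedPiece J d)
  have hbot : gradedPiece J d ⊓ LinearMap.ker (LinearMap.mulLeft K (Ideal.Quotient.mk J a)) = ⊥ := by
    rw [eq_bot_iff]
    rintro _ ⟨⟨p, hp, rfl⟩, hx'⟩
    have : a * p ∈ J := Ideal.Quotient.eq_zero_iff_mem.1 hx'
    exact Ideal.Quotient.eq_zero_iff_mem.2 (hreg _ this)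
  rw [hbot, finrank_bot, add_zero] at hinj
  rw [hker, hinj, map_factor_gradedPiece] at h
  exact h

theorem isRegularMod_of_isSMulRegular {S : Type*} [CommRing S] {J : Ideal S} {a : S}
    (h : IsSMulRegular (S ⧸ (J • ⊤ : Submodule S S)) a) : IsRegularMod J a := by
  intro z hz
  have hJ : (J • ⊤ : Submodule S S) = J := by rw [smul_eq_mul, Ideal.mul_top]
  have h0 : a • (Submodule.Quotient.mk z : S ⧸ (J • ⊤ : Submodule S S)) = 0 := by
    rw [← Submodule.Quotient.mk_smul, Submodule.Quotient.mk_eq_zero, hJ]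
    exact hz
  have := h.right_eq_zero_of_smul h0
  rwa [Submodule.Quotient.mk_eq_zero, hJ] at this

theorem mixedIdeal_zero_extendZero {f : Fin n → MvPolynomial (Fin n) K} (m : ℕ) :
    mixedIdeal 0 (extendZero f) 0 m = Ideal.span (extendZero f '' Set.Iio m) := by
  rw [mixedIdeal]
  simp

theorem mixedIdeal_zero_extendZero_self {f : Fin n → MvPolynomial (Fin n) K} :
    mixedIdeal 0 (extendZero f) 0 n = Ideal.span (Set.range f) := by
  rw [mixedIdeal_zero_extendZero]
  congr 1
  ext p
  constructor
  · rintro ⟨m, hm, rfl⟩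
    exact ⟨⟨m, hm⟩, (extendZero_of_lt f hm).symm⟩
  · rintro ⟨m, rfl⟩
    exact ⟨m, m.2, extendZero_of_lt f m.2⟩

theorem isRegularMod_extendZero {f : Fin n → MvPolynomial (Fin n) K}
    (hf : RingTheory.Sequence.IsRegular (MvPolynomial (Fin n) K) (List.ofFn f)) {m : ℕ}
    (hm : m < n) : IsRegularMod (mixedIdeal 0 (extendZero f) 0 m) (extendZero f m) := by
  have h := isRegularMod_of_isSMulRegular (hf.regular_mod_prev m (by simpa using hm))
  rw [List.getElem_ofFn] at h
  rw [extendZero_of_lt f hm, mixedIdeal_zero_extendZero]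
  convert h using 1
  rw [Ideal.ofList]
  congr 1
  ext p
  simp only [Set.mem_image, Set.mem_Iio, Set.mem_ofPred_eq, List.mem_take_iff_getElem,
    List.getElem_ofFn, List.length_ofFn]
  constructor
  · rintro ⟨i, hi, rfl⟩
    exact ⟨i, by omega, (extendZero_of_lt f (by omega)).symm⟩
  · rintro ⟨i, hi, rfl⟩
    exact ⟨i, by omega, extendZero_of_lt f (by omega)⟩

/-- Hilbert function of a complete intersection of five quadrics in five variables. -/
theorem hilbertFunction_span_range {f : Fin 5 → MvPolynomial (Fin 5) K}
    (hf2 : ∀ i, (f i).IsHomogeneous 2)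
    (hf : RingTheory.Sequence.IsRegular (MvPolynomial (Fin 5) K) (List.ofFn f)) :
    hilbertFunction (Ideal.span (Set.range f)) 3 = 10 ∧
      hilbertFunction (Ideal.span (Set.range f)) 6 = 0 := by
  let H : ℕ → ℕ → ℕ := fun m d => hilbertFunction (mixedIdeal 0 (extendZero f) 0 m) d
  have h2 : ∀ m, (extendZero f m).IsHomogeneous 2 := fun m => by
    rw [extendZero]
    split_ifs with h
    exacts [hf2 _, isHomogeneous_zero _ _ _]
  have hJ : ∀ m, IsHomogeneousIdeal (mixedIdeal 0 (extendZero f) 0 m) := fun m => by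
    rw [mixedIdeal_zero_extendZero]
    refine isHomogeneousIdeal_span ?_
    rintro _ ⟨i, -, rfl⟩
    exact ⟨2, h2 i⟩
  have hlow : ∀ m d, d < 2 → H (m + 1) d = H m d := fun m d hd => by
    simp only [H]
    rw [mixedIdeal_succ_right]
    exact hilbertFunction_sup_span_of_lt (hJ m) (h2 m) hd
  have hrec : ∀ m d, m < 5 → H (m + 1) (2 + d) + H m d = H m (2 + d) := fun m d hm => by
    simp only [H]
    rw [mixedIdeal_succ_right]
    exact hilbertFunction_sup_span_add (hJ m) (h2 m) (isRegularMod_extendZero hf hm) d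
  have h0 : ∀ d, H 0 d = (5 + d - 1).choose d := fun d => by
    have : mixedIdeal 0 (extendZero f) 0 0 = ⊥ := by
      rw [mixedIdeal_zero_extendZero]; simp
    simp only [H]
    rw [this, hilbertFunction_bot]
  have e0 : H 0 0 = 1 := h0 0
  have e1 : H 0 1 = 5 := h0 1
  have e2 : H 0 2 = 15 := h0 2
  have e3 : H 0 3 = 35 := h0 3
  have e4 : H 0 4 = 70 := h0 4
  have e6 : H 0 6 = 210 := h0 6
  rw [← mixedIdeal_zero_extendZero_self]
  change H 5 3 = 10 ∧ H 5 6 = 0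
  -- The recursion multiplies the Hilbert series by `1 - t^2` five times, giving `(1+t)^5`; only odd
  -- degrees up to 3 and even degrees up to 6 enter.
  have l0 := fun m => hlow m 0 (by norm_num)
  have l1 := fun m => hlow m 1 (by norm_num)
  have r0 := fun m hm => hrec m 0 hm
  have r1 := fun m hm => hrec m 1 hm
  have r2 := fun m hm => hrec m 2 hm
  have r4 := fun m hm => hrec m 4 hm
  norm_num at r0 r1 r2 r4
  have a0 := l0 0; have a1 := l0 1; have a2 := l0 2; have a3 := l0 3
  have b0 := l1 0; have b1 := l1 1; have b2 := l1 2; have b3 := l1 3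
  have c0 := r0 0; have c1 := r0 1; have c2 := r0 2; have c3 := r0 3
  have d0 := r1 0; have d1 := r1 1; have d2 := r1 2; have d3 := r1 3; have d4 := r1 4
  have f0 := r2 0; have f1 := r2 1; have f2 := r2 2; have f3 := r2 3
  have g0 := r4 0; have g1 := r4 1; have g2 := r4 2; have g3 := r4 3; have g4 := r4 4
  norm_num at a0 a1 a2 a3 b0 b1 b2 b3 c0 c1 c2 c3 d0 d1 d2 d3 d4 f0 f1 f2 f3 g0 g1 g2 g3 g4
  omega

end HilbertFunction

/-! ### Descent along a field extension by linear functionals -/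

section CoefficientwiseFunctional

variable {K E σ : Type*} [Field K] [Field E] [Algebra K E]

/-- The map that applies a linear functional to every coefficient. -/
noncomputable def mapCoeff (φ : Module.Dual K E) (q : MvPolynomial σ E) : MvPolynomial σ K :=
  ∑ m ∈ q.support, monomial m (φ (coeff m q))

theorem coeff_mapCoeff (φ : Module.Dual K E) (q : MvPolynomial σ E) (m : σ →₀ ℕ) :
    coeff m (mapCoeff φ q) = φ (coeff m q) := by
  classical
  rw [mapCoeff, coeff_sum]
  simp only [coeff_monomial, Finset.sum_ite_eq']
  split_ifs with h
  · rfl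
  · rw [notMem_support_iff.1 h, map_zero]

theorem mapCoeff_sum {ι : Type*} (φ : Module.Dual K E) (s : Finset ι) (q : ι → MvPolynomial σ E) :
    mapCoeff φ (∑ i ∈ s, q i) = ∑ i ∈ s, mapCoeff φ (q i) := by
  ext m
  simp [coeff_mapCoeff, coeff_sum]

/-- Linearity over polynomials with coefficients in `K` is what lets relations over `E` descend to
`K`. -/
theorem mapCoeff_mul_map (φ : Module.Dual K E) (q : MvPolynomial σ E) (p : MvPolynomial σ K) :
    mapCoeff φ (q * map (algebraMap K E) p) = mapCoeff φ q * p := by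
  classical
  ext m
  rw [coeff_mapCoeff, coeff_mul, coeff_mul, map_sum]
  refine Finset.sum_congr rfl fun x _ => ?_
  rw [coeff_map, coeff_mapCoeff, mul_comm, ← Algebra.smul_def, map_smul, smul_eq_mul, mul_comm]

theorem isHomogeneous_mapCoeff (φ : Module.Dual K E) {q : MvPolynomial σ E} {d : ℕ}
    (hq : q.IsHomogeneous d) : (mapCoeff φ q).IsHomogeneous d := by
  intro m hm
  refine hq fun h0 => hm ?_
  rw [coeff_mapCoeff, h0, map_zero]

theorem eq_zero_of_mapCoeff_eq_zero {q : MvPolynomial σ E}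
    (h : ∀ φ : Module.Dual K E, mapCoeff φ q = 0) : q = 0 := by
  ext m
  rw [coeff_zero, ← Module.forall_dual_apply_eq_zero_iff K]
  intro φ
  rw [← coeff_mapCoeff, h φ, coeff_zero]

theorem mapCoeff_mem_span (φ : Module.Dual K E) {ι : Type*} [Fintype ι]
    {f : ι → MvPolynomial σ K} {q : MvPolynomial σ E}
    (hq : q ∈ Ideal.span (Set.range fun i => map (algebraMap K E) (f i))) :
    mapCoeff φ q ∈ Ideal.span (Set.range f) := by
  obtain ⟨c, rfl⟩ := Ideal.mem_span_range_iff_exists_fun.1 hq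
  rw [mapCoeff_sum]
  refine sum_mem fun i _ => ?_
  rw [mapCoeff_mul_map]
  exact Ideal.mul_mem_left _ _ (Ideal.subset_span ⟨i, rfl⟩)

theorem linearIndependent_map {ι : Type*} [Fintype ι] {f : ι → MvPolynomial σ K}
    (hf : LinearIndependent K f) : LinearIndependent E fun i => map (algebraMap K E) (f i) := by
  rw [Fintype.linearIndependent_iff] at hf ⊢
  intro c hc i
  rw [← Module.forall_dual_apply_eq_zero_iff K]
  intro φ
  refine hf (fun i => φ (c i)) ?_ i
  have hC : ∀ x : E, mapCoeff (σ := σ) φ (C x) = C (φ x) := fun x => by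
    classical
    ext m
    rw [coeff_mapCoeff, coeff_C, coeff_C]
    split_ifs <;> simp
  have h0 : mapCoeff (σ := σ) φ 0 = 0 := by ext m; simp [coeff_mapCoeff]
  rw [← h0, ← hc, mapCoeff_sum]
  refine Finset.sum_congr rfl fun i _ => ?_
  rw [smul_eq_C_mul, smul_eq_C_mul, mapCoeff_mul_map, hC]

theorem mem_span_map_of_isHomogeneous {f : Set (MvPolynomial σ K)} {N : ℕ}
    (hN : ∀ p : MvPolynomial σ K, p.IsHomogeneous N → p ∈ Ideal.span f)
    {q : MvPolynomial σ E} (hq : q.IsHomogeneous N) :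
    q ∈ Ideal.span (map (algebraMap K E) '' f) := by
  rw [← Ideal.map_span, q.as_sum]
  refine sum_mem fun m hm => ?_
  have hdeg : m.degree = N := by
    have := hq (mem_support_iff.1 hm)
    rwa [Finsupp.degree_eq_weight_one]
  have : monomial m (coeff m q) =
      C (coeff m q) * map (algebraMap K E) (monomial m (1 : K)) := by
    rw [map_monomial, map_one, C_mul_monomial, mul_one]
  rw [this]
  exact Ideal.mul_mem_left _ _
    (Ideal.mem_map_of_mem _ (hN _ (isHomogeneous_monomial 1 hdeg)))

end CoefficientwiseFunctional

/-! ### Five quadrics and their quotient ring -/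

section FiveQuadrics

variable {K : Type*} [Field K] {σ ι : Type*} [Fintype ι]

theorem eq_zero_of_mem_span_of_lt {f : ι → MvPolynomial σ K} {e d : ℕ}
    (hf : ∀ i, (f i).IsHomogeneous e) {p : MvPolynomial σ K} (hp : p.IsHomogeneous d)
    (hd : d < e) (hpf : p ∈ Ideal.span (Set.range f)) : p = 0 := by
  obtain ⟨c, rfl⟩ := Ideal.mem_span_range_iff_exists_fun.1 hpf
  rw [← homogeneousComponent_eq_self hp, map_sum]
  refine Finset.sum_eq_zero fun i _ => ?_
  rw [mul_comm, homogeneousComponent_mul_of_lt (hf i) _ hd]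

theorem mem_span_of_mem_ideal_span {f : ι → MvPolynomial σ K} {e : ℕ}
    (hf : ∀ i, (f i).IsHomogeneous e) {p : MvPolynomial σ K} (hp : p.IsHomogeneous e)
    (hpf : p ∈ Ideal.span (Set.range f)) : p ∈ Submodule.span K (Set.range f) := by
  obtain ⟨c, rfl⟩ := Ideal.mem_span_range_iff_exists_fun.1 hpf
  rw [← homogeneousComponent_eq_self hp, map_sum]
  refine sum_mem fun i _ => ?_
  have := homogeneousComponent_mul_of_isHomogeneous (hf i) (c i) 0
  rw [add_zero] at this
  rw [mul_comm, this, homogeneousComponent_zero, mul_comm, ← smul_eq_C_mul]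
  exact Submodule.smul_mem _ _ (Submodule.subset_span ⟨i, rfl⟩)

/-- The quadrics `g` stay linearly independent modulo `f`. -/
theorem linearIndependent_mk {κ : Type*} [Fintype κ] {f : ι → MvPolynomial σ K}
    {g : κ → MvPolynomial σ K} {e : ℕ} (hf : ∀ i, (f i).IsHomogeneous e)
    (hg : ∀ j, (g j).IsHomogeneous e) (hli : LinearIndependent K (Sum.elim f g)) :
    LinearIndependent K fun j => Ideal.Quotient.mk (Ideal.span (Set.range f)) (g j) := by
  rw [linearIndependent_sum] at hli
  obtain ⟨-, hgli, hdisj⟩ := hli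
  rw [Fintype.linearIndependent_iff] at hgli ⊢
  intro c hc
  refine hgli c ?_
  have hmem : ∑ j, c j • g j ∈ Ideal.span (Set.range f) := by
    rw [← Ideal.Quotient.eq_zero_iff_mem, ← hc, map_sum]
    rfl
  have hhom : (∑ j, c j • g j).IsHomogeneous e :=
    (homogeneousSubmodule σ K e).sum_mem fun j _ => Submodule.smul_mem _ _ (hg j)
  refine Submodule.disjoint_def.1 hdisj _ (mem_span_of_mem_ideal_span hf hhom hmem) ?_
  exact sum_mem fun j _ => Submodule.smul_mem _ _ (Submodule.subset_span ⟨j, rfl⟩)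

/-- Vanishing in degree 6 stands in for regularity of `f`, since generic quadrics recover a regular
sequence; unlike regularity, it passes to `E` by a check on monomials. -/
theorem hasSmallAnnihilators_gradedPiece [Infinite K] {f : Fin 5 → MvPolynomial (Fin 5) K}
    (hf : ∀ i, (f i).IsHomogeneous 2) (hfli : LinearIndependent K f)
    (h6 : ∀ p : MvPolynomial (Fin 5) K, p.IsHomogeneous 6 → p ∈ Ideal.span (Set.range f)) :
    HasSmallAnnihilators (K := K) (gradedPiece (Ideal.span (Set.range f))) where
  finite := inferInstance
  mul_mem := by
    rintro i j _ _ ⟨p, hp, rfl⟩ ⟨q, hq, rfl⟩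
    exact ⟨p * q, IsHomogeneous.mul hp hq, map_mul (Ideal.Quotient.mk _) p q⟩
  finrank_one := by
    have h := finrank_map_add_finrank_inf_ker
      (Ideal.Quotient.mkₐ K (Ideal.span (Set.range f))).toLinearMap
      (homogeneousSubmodule (Fin 5) K 1)
    have hbot : homogeneousSubmodule (Fin 5) K 1 ⊓ LinearMap.ker
        (Ideal.Quotient.mkₐ K (Ideal.span (Set.range f))).toLinearMap = ⊥ := by
      rw [eq_bot_iff]
      rintro p ⟨hp, hp'⟩
      exact eq_zero_of_mem_span_of_lt hf hp (by norm_num) (Ideal.Quotient.eq_zero_iff_mem.1 hp')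
    rw [hbot, finrank_bot, add_zero, finrank_homogeneousSubmodule_one] at h
    exact h
  eq_bot := by
    rw [eq_bot_iff]
    rintro _ ⟨p, hp, rfl⟩
    exact Ideal.Quotient.eq_zero_iff_mem.2 (h6 p hp)
  finrank_le _ _ _ _ hL hU hLU hdr := finrank_le_of_mul_eq_zero f hf hfli h6 hL hU hLU hdr

end FiveQuadrics

/-! ### Products under extension of scalars -/

section BaseChange

variable {K E : Type*} [Field K] [Field E] [Algebra K E] {n : ℕ} {ι κ : Type*}

/-- Extension of scalars does not increase the dimension of the space of products of linear forms
with the `g j`. -/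
theorem finrank_gradedPiece_one_mul_span_map_le [Finite κ] (f : ι → MvPolynomial (Fin n) K)
    (g : κ → MvPolynomial (Fin n) K) :
    Module.finrank E (gradedPiece (Ideal.span (Set.range fun i => map (algebraMap K E) (f i))) 1 *
      Submodule.span E (Set.range fun j => Ideal.Quotient.mk
        (Ideal.span (Set.range fun i => map (algebraMap K E) (f i)))
        (map (algebraMap K E) (g j))) : Submodule E _) ≤
    Module.finrank K (gradedPiece (Ideal.span (Set.range f)) 1 *
      Submodule.span K (Set.range fun j => Ideal.Quotient.mk (Ideal.span (Set.range f)) (g j)) :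
        Submodule K _) := by
  set I := Ideal.span (Set.range f) with hI
  set I' := Ideal.span (Set.range fun i => map (algebraMap K E) (f i)) with hI'
  have hII' : I ≤ I'.comap (map (algebraMap K E)) := by
    rw [hI, Ideal.span_le]
    rintro _ ⟨i, rfl⟩
    exact Ideal.subset_span ⟨i, rfl⟩
  let ψ : (MvPolynomial (Fin n) K ⧸ I) →+* MvPolynomial (Fin n) E ⧸ I' :=
    Ideal.quotientMap I' (map (algebraMap K E)) hII'
  have hψmk : ∀ p, ψ (Ideal.Quotient.mk I p) = Ideal.Quotient.mk I' (map (algebraMap K E) p) :=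
    fun p => rfl
  have hψsmul : ∀ (c : K) a, ψ (c • a) = algebraMap K E c • ψ a := by
    intro c a
    obtain ⟨p, rfl⟩ := Ideal.Quotient.mk_surjective a
    have h1 : c • Ideal.Quotient.mk I p = Ideal.Quotient.mk I (c • p) := rfl
    have h2 : algebraMap K E c • Ideal.Quotient.mk I' (map (algebraMap K E) p) =
      Ideal.Quotient.mk I' (algebraMap K E c • map (algebraMap K E) p) := rfl
    rw [h1, hψmk, hψmk, h2, smul_eq_C_mul, smul_eq_C_mul, map_mul, map_C]
  have hVfin : Module.Finite K
      (Submodule.span K (Set.range fun j => Ideal.Quotient.mk I (g j))) :=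
    Module.Finite.span_of_finite K (Set.finite_range _)
  set P : Submodule K (MvPolynomial (Fin n) K ⧸ I) := gradedPiece I 1 *
    Submodule.span K (Set.range fun j => Ideal.Quotient.mk I (g j)) with hP
  let t := Module.finBasis K P
  -- The image of a `K`-basis of the product space spans the corresponding space over `E`.
  have hψP : ∀ a ∈ P, ψ a ∈ Submodule.span E (Set.range fun i => ψ (t i)) := by
    intro a ha
    have := congrArg Subtype.val (t.sum_repr ⟨a, ha⟩)
    rw [Submodule.coe_sum] at this
    change _ = a at this
    rw [← this, map_sum]
    refine sum_mem fun i _ => ?_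
    rw [Submodule.coe_smul, hψsmul]
    exact Submodule.smul_mem _ _ (Submodule.subset_span ⟨i, rfl⟩)
  have hone : gradedPiece I' 1 = Submodule.span E
      (Set.range fun i => Ideal.Quotient.mk I' (X i)) := by
    rw [gradedPiece, homogeneousSubmodule_one_eq_span_X, Submodule.map_span, ← Set.range_comp]
    rfl
  have hle : gradedPiece I' 1 * Submodule.span E
      (Set.range fun j => Ideal.Quotient.mk I' (map (algebraMap K E) (g j))) ≤
      Submodule.span E (Set.range fun i => ψ (t i)) := by
    rw [hone, Submodule.span_mul_span, Submodule.span_le]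
    rintro _ ⟨_, ⟨i, rfl⟩, _, ⟨j, rfl⟩, rfl⟩
    have := hψP (Ideal.Quotient.mk I (X i) * Ideal.Quotient.mk I (g j))
      (Submodule.mul_mem_mul ⟨X i, isHomogeneous_X K i, rfl⟩ (Submodule.subset_span ⟨j, rfl⟩))
    rwa [map_mul, hψmk, hψmk, map_X] at this
  have : Module.Finite E (Submodule.span E (Set.range fun i => ψ (t i))) :=
    Module.Finite.span_of_finite E (Set.finite_range _)
  refine (Submodule.finrank_mono hle).trans ((finrank_range_le_card _).trans ?_)
  rw [Fintype.card_fin]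

end BaseChange

end QuadricEGH

/-! ### The bound over an arbitrary field -/

theorem mainTheorem7 {K : Type*} [Field K]
    (I : Ideal (MvPolynomial (Fin 5) K))
    (f : Fin 5 → MvPolynomial (Fin 5) K) (g : Fin 3 → MvPolynomial (Fin 5) K)
    (hI : QuadricEGH.IsDefectQuadraticIdeal I 3 f g)
    (hAnn : Module.finrank K (QuadricEGH.annPiece (Ideal.span (Set.range f)) g 1) = 0) :
    QuadricEGH.hilbertFunction I 3 ≤ 4 := by
  open QuadricEGH MvPolynomial in
  obtain ⟨h3, h6⟩ := hilbertFunction_span_range hI.quadratic_f hI.regular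
  have h6' : ∀ p : MvPolynomial (Fin 5) K, p.IsHomogeneous 6 →
      p ∈ Ideal.span (Set.range f) := fun p hp => by
    rw [hilbertFunction, Submodule.finrank_eq_zero] at h6
    have : Ideal.Quotient.mk (Ideal.span (Set.range f)) p ∈
        gradedPiece (Ideal.span (Set.range f)) 6 := ⟨p, hp, rfl⟩
    rw [h6, Submodule.mem_bot] at this
    exact Ideal.Quotient.eq_zero_iff_mem.1 this
  have hannbot : annPiece (Ideal.span (Set.range f)) g 1 = ⊥ := by
    have : Module.Finite K (annPiece (Ideal.span (Set.range f)) g 1) :=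
      Submodule.finiteDimensional_of_le
        (fun a ha => ha.1 : annPiece _ g 1 ≤ gradedPiece (Ideal.span (Set.range f)) 1)
    exact Submodule.finrank_eq_zero.1 hAnn
  -- The closure supplies both eigenvectors and the infinitely many scalars that prime avoidance
  -- needs.
  let E := AlgebraicClosure K
  let f' : Fin 5 → MvPolynomial (Fin 5) E := fun i => map (algebraMap K E) (f i)
  let g' : Fin 3 → MvPolynomial (Fin 5) E := fun j => map (algebraMap K E) (g j)
  have hf' : ∀ i, (f' i).IsHomogeneous 2 := fun i => (hI.quadratic_f i).map _
  have hg' : ∀ j, (g' j).IsHomogeneous 2 := fun j => (hI.quadratic_g j).map _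
  have hli : LinearIndependent E (Sum.elim f' g') := by
    convert linearIndependent_map (E := E) hI.linearIndependent using 1
    ext1 (i | j) <;> rfl
  have hE6 : ∀ p : MvPolynomial (Fin 5) E, p.IsHomogeneous 6 →
      p ∈ Ideal.span (Set.range f') := fun p hp => by
    have := mem_span_map_of_isHomogeneous (E := E) h6' hp
    rwa [← Set.range_comp] at this
  have hD := hasSmallAnnihilators_gradedPiece hf' (hli.comp Sum.inl Sum.inl_injective) hE6
  have h6E := hD.six_le_finrank_mul
    (V := Submodule.span E (Set.range fun j =>
      Ideal.Quotient.mk (Ideal.span (Set.range f')) (g' j)))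
    (by
      rw [Submodule.span_le]
      rintro _ ⟨j, rfl⟩
      exact ⟨g' j, hg' j, rfl⟩)
    (by rw [finrank_span_eq_card (linearIndependent_mk hf' hg' hli), Fintype.card_fin])
    (by
      rintro _ ⟨p, hp, rfl⟩ hl
      -- Each functional turns a linear annihilator over `E` into one over `K`, which is zero by
      -- hypothesis.
      have hp0 : p = 0 := eq_zero_of_mapCoeff_eq_zero (K := K) fun φ => by
        have hφ := isHomogeneous_mapCoeff φ hp
        refine eq_zero_of_mem_span_of_lt hI.quadratic_f hφ (by norm_num) ?_
        have hmem : Ideal.Quotient.mk (Ideal.span (Set.range f)) (mapCoeff φ p) ∈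
            annPiece (Ideal.span (Set.range f)) g 1 := by
          refine ⟨⟨_, hφ, rfl⟩, fun j => ?_⟩
          rw [← map_mul, Ideal.Quotient.eq_zero_iff_mem, ← mapCoeff_mul_map]
          exact mapCoeff_mem_span φ (Ideal.Quotient.eq_zero_iff_mem.1
            (hl _ (Submodule.subset_span ⟨j, rfl⟩)))
        rw [hannbot, Submodule.mem_bot] at hmem
        exact Ideal.Quotient.eq_zero_iff_mem.1 hmem
      rw [hp0, map_zero])
  have h6K := h6E.trans (finrank_gradedPiece_one_mul_span_map_le f g)
  have hle : Ideal.span (Set.range f) ≤ I := hI.eq_sup ▸ le_sup_left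
  have hrank := finrank_map_add_finrank_inf_ker (Ideal.Quotient.factorₐ K hle).toLinearMap
    (gradedPiece (Ideal.span (Set.range f)) 3)
  rw [map_factor_gradedPiece] at hrank
  have hsub : gradedPiece (Ideal.span (Set.range f)) 1 * Submodule.span K
      (Set.range fun j => Ideal.Quotient.mk (Ideal.span (Set.range f)) (g j)) ≤
      gradedPiece (Ideal.span (Set.range f)) 3 ⊓
        LinearMap.ker (Ideal.Quotient.factorₐ K hle).toLinearMap := by
    rw [gradedPiece, homogeneousSubmodule_one_eq_span_X, Submodule.map_span,
      Submodule.span_mul_span, Submodule.span_le]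
    rintro _ ⟨_, ⟨_, ⟨i, rfl⟩, rfl⟩, _, ⟨j, rfl⟩, rfl⟩
    refine ⟨⟨X i * g j, (isHomogeneous_X K i).mul (hI.quadratic_g j),
      map_mul (Ideal.Quotient.mk _) _ _⟩, ?_⟩
    refine (mk_mem_ker_factor hle (p := X i * g j)).2 (Ideal.mul_mem_left _ _ ?_)
    rw [hI.eq_sup]
    exact Ideal.mem_sup_right (Ideal.subset_span ⟨j, rfl⟩)
  have := Submodule.finrank_mono hsub
  rw [hilbertFunction] at h3 ⊢
  -- The kernel of `A_3 → (R/I)_3` has dimension at least 6, leaving at most `10 - 6 = 4`.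
  omega
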